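/- Let $G$ be a finite simple graph (undirected, without loops or multiple edges). Suppose that $G$ is an Euler graph, i.e. $G$ is connected and has a closed walk that traverses every edge of $G$ exactly once, and that every cycle of $G$ has length congruent to $3$ modulo $4$ (that is, $G$ belongs to the class $\epsilon_3$). Then $G$ is planar: its vertices can be represented by distinct points of $\mathbb{R}^2$ and its edges by simple (non-self-intersecting) arcs joining the points of their two ends, in such a way that no arc passes through a vertex other than its ends, and two different arcs meet only in points representing common ends. -/

import Mathlib

/-- An Euler graph: a connected graph that has a closed walk traversing every edge exactly once. -/
def IsEulerGraph {V : Type*} [DecidableEq V] (G : SimpleGraph V) : Prop :=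
  G.Connected ∧ ∃ (u : V) (p : G.Walk u u), p.IsEulerian

/-- `OnlyCyclesMod4 G i`: every cycle of `G` has length `n` with `n ≡ i (mod 4)`. -/
def OnlyCyclesMod4 {V : Type*} (G : SimpleGraph V) (i : ℕ) : Prop :=
  ∀ (u : V) (p : G.Walk u u), p.IsCycle → p.length ≡ i [MOD 4]

/-- The class `ε_i` of Euler graphs with only cycles of length `≡ i (mod 4)`. -/
def InEpsilon {V : Type*} [DecidableEq V] (i : ℕ) (G : SimpleGraph V) : Prop :=
  IsEulerGraph G ∧ OnlyCyclesMod4 G i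

/-- `A` is a simple (non-self-intersecting) arc in the plane with ends `a` and `b`. -/
def IsSimpleArc (A : Set (ℝ × ℝ)) (a b : ℝ × ℝ) : Prop :=
  ∃ γ : Path a b, Function.Injective γ ∧ Set.range γ = A

/-- `G` is planar: it can be drawn in the plane with distinct points as vertices and simple arcs
as edges, such that an edge passes through no vertex other than its two ends, and two distinct
edges meet only in common ends. -/
def IsPlanarGraph {V : Type*} (G : SimpleGraph V) : Prop :=
  ∃ (point : V → ℝ × ℝ) (arc : Sym2 V → Set (ℝ × ℝ)),
    Function.Injective point ∧
    (∀ u v : V, G.Adj u v → IsSimpleArc (arc s(u, v)) (point u) (point v)) ∧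
    (∀ e ∈ G.edgeSet, ∀ w : V, point w ∈ arc e → w ∈ e) ∧
    (∀ e ∈ G.edgeSet, ∀ f ∈ G.edgeSet, e ≠ f →
      ∀ x ∈ arc e ∩ arc f, ∃ w : V, w ∈ e ∧ w ∈ f ∧ point w = x)

/-! Lengths congruent to 3 mod 4 are odd, and odd cycles cannot be linked: a path joining two
vertices of a cycle off its edges would give three paths with the same ends, whose pairwise length
sums are all odd although they add up to an even number (`IsCycle.eq_of_walk_disjoint`). So a cycle
cut out of the closed Euler trail touches the rest in one vertex `v`. By induction the vertices go
on a line without interleaving edges, the cycle being inserted in order just right of `v`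
(`IsTrail.exists_noncrossing`). Lifting the line to a parabola and drawing edges as chords gives a
plane drawing (`isPlanarGraph_of_noncrossing`). -/

namespace SimpleGraph.Walk

variable {V : Type*} {G : SimpleGraph V}

/-! ### Cycles when all cycles are odd -/

/-- Two paths with the same distinct ends that share neither an inner vertex nor an edge
form a cycle. -/
lemma IsPath.isCycle_append_reverse {u w : V} {p q : G.Walk u w} (hp : p.IsPath) (hq : q.IsPath)
    (huw : u ≠ w) (hs : ∀ x ∈ p.support, x ∈ q.support → x = u ∨ x = w)
    (he : p.edges.Disjoint q.edges) : (p.append q.reverse).IsCycle := by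
  refine hp.isCycle_append hq.reverse ?_ ?_
  · intro x hxp hxq
    have hxu : x ≠ u := by
      rintro rfl
      have h := hp.support_nodup
      rw [← cons_tail_support] at h
      exact (List.nodup_cons.mp h).1 hxp
    have hxw : x ≠ w := by
      rintro rfl
      have h := hq.reverse.support_nodup
      rw [← cons_tail_support] at h
      exact (List.nodup_cons.mp h).1 hxq
    have h2 : x ∈ q.support := by simpa using List.mem_of_mem_tail hxq
    rcases hs x (List.mem_of_mem_tail hxp) h2 with h | h
    · exact hxu h
    · exact hxw h
  · by_contra! hlen
    rw [length_reverse] at hlen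
    have key : ∀ r : G.Walk u w, r.length ≤ 1 → s(u, w) ∈ r.edges := by
      intro r hr
      cases r with
      | nil => exact absurd rfl huw
      | cons h r' =>
        cases r' with
        | nil => simp
        | cons h' r'' => simp at hr
    exact he (key p hlen.1) (key q hlen.2)

/-- If all cycles are odd, then no walk avoiding the edges of a cycle joins two distinct vertices
of that cycle. -/
lemma IsCycle.eq_of_walk_disjoint [DecidableEq V]
    (hodd : ∀ (v : V) (c : G.Walk v v), c.IsCycle → Odd c.length)
    {v : V} {c : G.Walk v v} (hc : c.IsCycle) {u w : V} (hu : u ∈ c.support)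
    (hw : w ∈ c.support) (q : G.Walk u w) (hq : q.edges.Disjoint c.edges) : u = w := by
  induction hn : q.length using Nat.strongRec generalizing u w with | ind n ih =>
  subst hn
  by_contra huw
  wlog hqp : q.IsPath generalizing q
  · rcases q.length_bypass_le_length.lt_or_eq with h | h
    · exact huw (ih _ h hu hw q.bypass
        (fun e he => hq (q.edges_bypass_subset_edges he)) rfl)
    · exact this q.bypass (fun e he => hq (q.edges_bypass_subset_edges he))
        (by rw [h]; exact ih) q.bypass_isPath
  -- An inner vertex of `q` on the cycle would cut off a shorter walk between two distinct cycle
  -- vertices.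
  have hin : ∀ x ∈ c.support, x ∈ q.support → x = u ∨ x = w := by
    intro x hxc hxq
    by_contra! hne
    exact hne.1 (ih _ (length_takeUntil_lt_length hxq hne.2) hu hxc (q.takeUntil x hxq)
      (fun e he => hq (q.edges_takeUntil_subset_edges hxq he)) rfl).symm
  have hr : (c.rotate u hu).IsCycle := hc.rotate hu
  have hwr : w ∈ (c.rotate u hu).support := (mem_support_rotate_iff c u hu).2 hw
  have hrs : ∀ x ∈ (c.rotate u hu).support, x ∈ c.support := fun x hx =>
    (mem_support_rotate_iff c u hu).1 hx
  have hre : ∀ e ∈ (c.rotate u hu).edges, e ∈ c.edges := fun e he =>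
    (rotate_edges c u hu).perm.mem_iff.1 he
  generalize c.rotate u hu = r at *
  have hA := hr.isPath_takeUntil hwr
  have hB : (r.dropUntil w hwr).IsPath := by
    rw [← take_spec r hwr] at hr
    exact hr.isPath_of_append_right (not_nil_of_ne huw)
  -- `q` and the two arcs of the cycle between `u` and `w` are the three paths of the parity
  -- argument.
  have h1 := hodd _ _ <| hA.isCycle_append_reverse hqp huw
    (fun x hx hx' => hin x (hrs x (r.support_takeUntil_subset_support hwr hx)) hx')
    (fun e he he' => hq he' (hre e (r.edges_takeUntil_subset_edges hwr he)))
  have h2 := hodd _ _ <| hB.isCycle_append_reverse hqp.reverse (Ne.symm huw)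
    (fun x hx hx' => (hin x (hrs x (r.support_dropUntil_subset_support hwr hx))
      (by simpa using hx')).symm)
    (fun e he he' => hq (by simpa using he') (hre e (r.edges_dropUntil_subset_edges hwr he)))
  have h3 := hodd _ _ hr
  have h4 := congrArg length (take_spec r hwr)
  simp only [length_append, length_reverse] at h1 h2 h4
  grind

/-! ### Non-interleaving placement on a line -/

lemma idxOf_support_start [DecidableEq V] {u v : V} (p : G.Walk u v) : p.support.idxOf u = 0 := by
  cases p <;> simp

/-- Along an edge of a cycle, the index of the first occurrence either increases by one or one of
the ends is the base vertex. -/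
lemma IsCycle.idxOf_support_of_mem_edges [DecidableEq V] {v : V} {c : G.Walk v v} (hc : c.IsCycle)
    {x y : V} (h : s(x, y) ∈ c.edges) (hlt : c.support.idxOf x < c.support.idxOf y) :
    c.support.idxOf x = 0 ∨ c.support.idxOf y = c.support.idxOf x + 1 := by
  -- Position `c.length` is excluded: the base vertex recurs there, with index 0.
  have hidx : ∀ i < c.length, c.support.idxOf (c.getVert i) = i := by
    intro i hi
    have hmem := c.getVert_mem_support i
    have hle : c.support.idxOf (c.getVert i) ≤ i := by
      rw [c.getVert_eq_support_getElem hi.le]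
      by_contra! h
      have h' := List.not_of_lt_findIdx h
      simp at h'
    refine hc.getVert_injOn' (by simp; omega) (by simp; omega) ?_
    rw [c.getVert_eq_support_getElem (by omega)]
    exact List.getElem_idxOf (List.idxOf_lt_length_of_mem hmem)
  obtain ⟨i, hi, hxy⟩ := (mk_mem_edges_iff_exists c).1 h
  have hv := c.idxOf_support_start
  have h1 := hidx i hi
  have h2 : c.support.idxOf (c.getVert (i + 1)) = i + 1 ∨
      c.support.idxOf (c.getVert (i + 1)) = 0 := by
    rcases (Nat.succ_le_of_lt hi).lt_or_eq with h' | h'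
    · exact .inl (hidx _ h')
    · right; rw [show i + 1 = c.length from h', getVert_length, hv]
  rcases Sym2.eq_iff.1 hxy with ⟨rfl, rfl⟩ | ⟨rfl, rfl⟩ <;> omega

/-- If all cycles are odd, the vertices of a closed trail can be placed on a line so that no two of
its edges interleave. -/
lemma IsTrail.exists_noncrossing [DecidableEq V]
    (hodd : ∀ (v : V) (c : G.Walk v v), c.IsCycle → Odd c.length)
    {u : V} (p : G.Walk u u) (hp : p.IsTrail) :
    ∃ f : V → ℝ, Set.InjOn f {x | x ∈ p.support} ∧
      ∀ a b c d, s(a, c) ∈ p.edges → s(b, d) ∈ p.edges → f a < f b → f b < f c → f c < f d →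
        False := by
  induction hn : p.length using Nat.strongRec generalizing p with | ind n ih =>
  subst hn
  by_cases hpath : p.IsPath
  · have hnil := (p.isPath_iff_nil.1 hpath).eq_nil
    subst hnil
    exact ⟨fun _ => 0, fun x hx y hy _ => by simp_all, by simp⟩
  rw [hp.isPath_iff_isSubwalk_imp_not_isCycle] at hpath
  push Not at hpath
  obtain ⟨v, c, ⟨q, r, hpq⟩, hc⟩ := hpath
  have hpos := hc.three_le_length
  have hedges : p.edges = q.edges ++ c.edges ++ r.edges := by simp [hpq]
  have hnodup := hp.edges_nodup
  rw [hedges] at hnodup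
  have hdisj : (q.append r).edges.Disjoint c.edges := by
    intro e he hec
    simp only [edges_append, List.mem_append] at he
    rw [List.nodup_append', List.nodup_append'] at hnodup
    rcases he with he | he
    · exact hnodup.1.2.2 he hec
    · exact hnodup.2.2 (List.mem_append_right _ hec) he
  have htrail : (q.append r).IsTrail := by
    rw [isTrail_def, edges_append]
    refine hnodup.sublist ?_
    exact (List.sublist_append_left _ _).append (List.Sublist.refl _)
  obtain ⟨f, hinj, hcross⟩ := ih _ (by simp [hpq]; omega) (q.append r) htrail rfl
  have hvs : v ∈ (q.append r).support := by simp
  have hmeet : ∀ x ∈ (q.append r).support, x ∈ c.support → x = v := by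
    intro x hx hxc
    simp only [mem_support_append_iff] at hx
    rcases hx with hx | hx
    · refine hc.eq_of_walk_disjoint hodd hxc c.start_mem_support (q.dropUntil x hx) ?_
      exact fun e he => hdisj (by simp [q.edges_dropUntil_subset_edges hx he])
    · refine (hc.eq_of_walk_disjoint hodd c.start_mem_support hxc (r.takeUntil x hx) ?_).symm
      exact fun e he => hdisj (by simp [r.edges_takeUntil_subset_edges hx he])
  have hsupp : ∀ x ∈ p.support, x ∈ (q.append r).support ∨ x ∈ c.support := by
    intro x hx
    rw [hpq] at hx
    simp only [mem_support_append_iff] at hx ⊢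
    tauto
  have hmemp : ∀ e ∈ p.edges, e ∈ (q.append r).edges ∨ e ∈ c.edges := by
    intro e he
    rw [hedges] at he
    simp only [edges_append, List.mem_append] at he ⊢
    tauto
  generalize q.append r = p' at *
  -- No vertex of the remaining trail is placed strictly between `f v` and `f v + ε`; the cycle goes
  -- there.
  obtain ⟨ε, hε, hgap⟩ : ∃ ε > 0, ∀ x ∈ p'.support, f v < f x → f v + ε ≤ f x := by
    have : ∀ l : List V, ∃ ε > 0, ∀ x ∈ l, f v < f x → f v + ε ≤ f x := by
      intro l
      induction l with
      | nil => exact ⟨1, one_pos, by simp⟩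
      | cons y l ihl =>
        obtain ⟨ε, hε, h⟩ := ihl
        by_cases hy : f v < f y
        · refine ⟨min ε (f y - f v), lt_min hε (by linarith), ?_⟩
          intro x hx hlt
          rcases List.mem_cons.1 hx with rfl | hx
          · linarith [min_le_right ε (f x - f v)]
          · linarith [min_le_left ε (f y - f v), h x hx hlt]
        · refine ⟨ε, hε, ?_⟩
          intro x hx hlt
          rcases List.mem_cons.1 hx with rfl | hx
          · exact absurd hlt hy
          · exact h x hx hlt
    exact this _
  -- Indices in `c.support` are at most `c.length`, so steps of `δ` stay below `f v + ε`.
  set δ : ℝ := ε / (c.length + 1) with hδ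
  have hL : (0 : ℝ) < c.length + 1 := by positivity
  have hδ0 : 0 < δ := by positivity
  let g : V → ℝ := fun x => if x ∈ p'.support then f x else f v + δ * c.support.idxOf x
  have hgp : ∀ x ∈ p'.support, g x = f x := fun x hx => by simp [g, hx]
  have hv0 := c.idxOf_support_start
  have hgc : ∀ x ∈ c.support, g x = f v + δ * c.support.idxOf x := by
    intro x hx
    by_cases hxp : x ∈ p'.support
    · rw [hgp x hxp, hmeet x hxp hx, hv0]; simp
    · simp [g, hxp]
  have hlt : ∀ x ∈ c.support, g x < f v + ε := by
    intro x hx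
    rw [hgc x hx]
    have h1 : c.support.idxOf x < c.length + 1 := by
      rw [← c.length_support]; exact List.idxOf_lt_length_iff.2 hx
    have h2 : (c.support.idxOf x : ℝ) < c.length + 1 := by exact_mod_cast h1
    have h3 : δ * (c.length + 1) = ε := by rw [hδ]; field_simp
    nlinarith
  have hge : ∀ x ∈ c.support, f v ≤ g x := by
    intro x hx
    rw [hgc x hx]
    have : 0 ≤ δ * (c.support.idxOf x : ℝ) := by positivity
    linarith
  have hgap' : ∀ x ∈ p'.support, g x ≤ f v ∨ f v + ε ≤ g x := by
    intro x hx
    rw [hgp x hx]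
    by_cases h : f v < f x
    · exact .inr (hgap x hx h)
    · exact .inl (not_lt.1 h)
  have hidx : ∀ x ∈ c.support, ∀ y ∈ c.support, g x < g y →
      c.support.idxOf x < c.support.idxOf y := by
    intro x hx y hy h
    rw [hgc x hx, hgc y hy] at h
    have : (c.support.idxOf x : ℝ) < c.support.idxOf y := by
      by_contra! h'
      have := mul_le_mul_of_nonneg_left h' hδ0.le
      linarith
    exact_mod_cast this
  have hmix : ∀ x ∈ p'.support, ∀ y ∈ c.support, g x = g y → x = y := by
    intro x hx y hy h
    have hxv : g x = f v := by
      rcases hgap' x hx with h' | h'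
      · exact le_antisymm h' (h ▸ hge y hy)
      · linarith [hlt y hy]
    have h1 : x = v := hinj hx hvs (by rw [← hgp x hx, hxv])
    rw [h, hgc y hy] at hxv
    have h2 : (c.support.idxOf y : ℝ) = 0 := by
      have : δ * (c.support.idxOf y : ℝ) = 0 := by linarith
      exact (mul_eq_zero.1 this).resolve_left hδ0.ne'
    have h3 : c.support.idxOf y = c.support.idxOf v := by rw [hv0]; exact_mod_cast h2
    rw [h1]
    exact ((List.idxOf_inj hy).1 h3).symm
  refine ⟨g, ?_, ?_⟩
  · intro x hx y hy hxy
    rcases hsupp x hx with hx | hx <;> rcases hsupp y hy with hy | hy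
    · exact hinj hx hy (by rw [← hgp x hx, ← hgp y hy, hxy])
    · exact hmix x hx y hy hxy
    · exact (hmix y hy x hx hxy.symm).symm
    · rw [hgc x hx, hgc y hy] at hxy
      have : (c.support.idxOf x : ℝ) = c.support.idxOf y :=
        mul_left_cancel₀ hδ0.ne' (by linarith)
      exact (List.idxOf_inj hx).1 (by exact_mod_cast this)
  · intro a b x d hac hbd h1 h2 h3
    rcases hmemp _ hac with hac | hac <;> rcases hmemp _ hbd with hbd | hbd
    · have ha := p'.fst_mem_support_of_mem_edges hac
      have hx := p'.snd_mem_support_of_mem_edges hac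
      have hb := p'.fst_mem_support_of_mem_edges hbd
      have hd := p'.snd_mem_support_of_mem_edges hbd
      rw [hgp a ha, hgp b hb] at h1
      rw [hgp x hx, hgp b hb] at h2
      rw [hgp x hx, hgp d hd] at h3
      exact hcross a b x d hac hbd h1 h2 h3
    · have hx := hgap' x (p'.snd_mem_support_of_mem_edges hac)
      have hb := hge b (c.fst_mem_support_of_mem_edges hbd)
      have hd := hlt d (c.snd_mem_support_of_mem_edges hbd)
      rcases hx with hx | hx <;> linarith
    · have hb := hgap' b (p'.fst_mem_support_of_mem_edges hbd)
      have ha := hge a (c.fst_mem_support_of_mem_edges hac)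
      have hx := hlt x (c.snd_mem_support_of_mem_edges hac)
      rcases hb with hb | hb <;> linarith
    · have ha := c.fst_mem_support_of_mem_edges hac
      have hx := c.snd_mem_support_of_mem_edges hac
      have hb := c.fst_mem_support_of_mem_edges hbd
      have hd := c.snd_mem_support_of_mem_edges hbd
      have i1 := hidx _ ha _ hb h1
      have i2 := hidx _ hb _ hx h2
      have i3 := hidx _ hx _ hd h3
      have j1 := hc.idxOf_support_of_mem_edges hac (i1.trans i2)
      have j2 := hc.idxOf_support_of_mem_edges hbd (i2.trans i3)
      -- The edge from `b` to `d` skips `x`, so `b` would have index 0, yet `a` has a smaller index.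
      omega

/-- A closed Eulerian walk in a connected graph visits every vertex. -/
lemma IsEulerian.mem_support_of_connected [DecidableEq V] (hG : G.Connected) {u : V}
    {p : G.Walk u u} (hp : p.IsEulerian) (w : V) : w ∈ p.support := by
  obtain ⟨q⟩ := hG.preconnected w u
  cases q with
  | nil => exact p.start_mem_support
  | cons h _ => exact p.fst_mem_support_of_mem_edges (hp.mem_edges_iff.2 h)

end SimpleGraph.Walk

/-! ### Drawing with chords of a parabola -/

/-- The point of the standard parabola over `t`. -/
def parabolaPoint (t : ℝ) : ℝ × ℝ := (t, t ^ 2)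

lemma parabolaPoint_injective : Function.Injective parabolaPoint :=
  fun _ _ h => congrArg Prod.fst h

lemma isSimpleArc_segment {a b : ℝ × ℝ} (h : a ≠ b) : IsSimpleArc (segment ℝ a b) a b := by
  refine ⟨⟨⟨fun t : unitInterval => AffineMap.lineMap a b (t : ℝ), ?_⟩, by simp, by simp⟩, ?_, ?_⟩
  · exact AffineMap.lineMap_continuous.comp continuous_subtype_val
  · intro s t hst
    exact Subtype.ext (AffineMap.lineMap_injective ℝ h hst)
  · rw [segment_eq_image_lineMap]
    ext x
    simp only [Set.mem_range, Set.mem_image]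
    constructor
    · rintro ⟨t, rfl⟩
      exact ⟨t, t.2, rfl⟩
    · rintro ⟨t, ht, rfl⟩
      exact ⟨⟨t, ht⟩, rfl⟩

/-- A point on a chord of the parabola lies between the ends, and its height above the parabola is
the product of the distances to the ends. -/
lemma mem_segment_parabolaPoint {a b : ℝ} (hab : a ≤ b) {x : ℝ × ℝ}
    (hx : x ∈ segment ℝ (parabolaPoint a) (parabolaPoint b)) :
    a ≤ x.1 ∧ x.1 ≤ b ∧ x.2 - x.1 ^ 2 = (x.1 - a) * (b - x.1) := by
  obtain ⟨s, t, hs, ht, hst, rfl⟩ := hx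
  obtain rfl : s = 1 - t := by linarith
  simp only [parabolaPoint, Prod.smul_mk, Prod.mk_add_mk, smul_eq_mul]
  refine ⟨by nlinarith, by nlinarith, by ring⟩

/-- Two chords of the parabola whose ends do not interleave meet only in common ends. -/
lemma chord_inter_chord {a b c d : ℝ} (hab : a < b) (hcd : c < d) (hne : ¬(a = c ∧ b = d))
    (h1 : ¬(a < c ∧ c < b ∧ b < d)) (h2 : ¬(c < a ∧ a < d ∧ d < b)) {x : ℝ × ℝ}
    (hx : x ∈ segment ℝ (parabolaPoint a) (parabolaPoint b))
    (hx' : x ∈ segment ℝ (parabolaPoint c) (parabolaPoint d)) :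
    ∃ t, (t = a ∨ t = b) ∧ (t = c ∨ t = d) ∧ parabolaPoint t = x := by
  obtain ⟨l1, l2, l3⟩ := mem_segment_parabolaPoint hab.le hx
  obtain ⟨m1, m2, m3⟩ := mem_segment_parabolaPoint hcd.le hx'
  -- A common point on the parabola is an end of both chords; any other is interior to both.
  by_cases h0 : x.2 - x.1 ^ 2 = 0
  · refine ⟨x.1, ?_, ?_, Prod.ext rfl (by simp [parabolaPoint]; linarith)⟩
    · rcases mul_eq_zero.1 (l3 ▸ h0) with h | h
      · left; linarith
      · right; linarith
    · rcases mul_eq_zero.1 (m3 ▸ h0) with h | h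
      · left; linarith
      · right; linarith
  exfalso
  have hpa : 0 < x.1 - a := lt_of_le_of_ne (by linarith) (fun h => h0 (by rw [l3, ← h, zero_mul]))
  have hpb : 0 < b - x.1 := lt_of_le_of_ne (by linarith) (fun h => h0 (by rw [l3, ← h, mul_zero]))
  have hpc : 0 < x.1 - c := lt_of_le_of_ne (by linarith) (fun h => h0 (by rw [m3, ← h, zero_mul]))
  have hpd : 0 < d - x.1 := lt_of_le_of_ne (by linarith) (fun h => h0 (by rw [m3, ← h, mul_zero]))
  have heq : (x.1 - a) * (b - x.1) = (x.1 - c) * (d - x.1) := by rw [← l3, m3]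
  -- Since the open intervals overlap without interleaving, one contains the other, and the larger
  -- has the strictly larger height product unless they coincide.
  rcases lt_trichotomy a c with hac | hac | hac
  · have hdb : d ≤ b := by
      by_contra! h
      exact h1 ⟨hac, by linarith, h⟩
    nlinarith [mul_lt_mul_of_pos_right (show x.1 - c < x.1 - a by linarith) hpd,
      mul_le_mul_of_nonneg_left (show d - x.1 ≤ b - x.1 by linarith) hpa.le]
  · subst hac
    exact hne ⟨rfl, by linarith [mul_left_cancel₀ hpa.ne' heq]⟩
  · have hbd : b ≤ d := by
      by_contra! h
      exact h2 ⟨hac, by linarith, h⟩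
    nlinarith [mul_lt_mul_of_pos_right (show x.1 - a < x.1 - c by linarith) hpb,
      mul_le_mul_of_nonneg_left (show b - x.1 ≤ d - x.1 by linarith) hpc.le]

/-- A graph whose vertices can be placed on a line without interleaving edges is planar. -/
lemma isPlanarGraph_of_noncrossing {V : Type*} {G : SimpleGraph V} (f : V → ℝ)
    (hf : Function.Injective f)
    (hcross : ∀ a b c d, G.Adj a c → G.Adj b d → f a < f b → f b < f c → f c < f d → False) :
    IsPlanarGraph G := by
  let point : V → ℝ × ℝ := fun v => parabolaPoint (f v)
  have hpoint : Function.Injective point := parabolaPoint_injective.comp hf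
  let arc : Sym2 V → Set (ℝ × ℝ) := Sym2.lift
    ⟨fun u v => segment ℝ (point u) (point v), fun u v => segment_symm ℝ _ _⟩
  have harc : ∀ u v, arc s(u, v) = segment ℝ (point u) (point v) := fun _ _ => rfl
  have hordered : ∀ e ∈ G.edgeSet, ∃ u v, e = s(u, v) ∧ G.Adj u v ∧ f u < f v := by
    intro e he
    induction e with | h u v =>
    rcases lt_or_gt_of_ne (hf.ne (G.ne_of_adj he)) with h | h
    · exact ⟨u, v, rfl, he, h⟩
    · exact ⟨v, u, Sym2.eq_swap, G.adj_symm he, h⟩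
  refine ⟨point, arc, hpoint, ?_, ?_, ?_⟩
  · intro u v huv
    exact isSimpleArc_segment (hpoint.ne (G.ne_of_adj huv))
  · intro e he w hw
    obtain ⟨u, v, rfl, -, hlt⟩ := hordered e he
    obtain ⟨-, -, h⟩ := mem_segment_parabolaPoint hlt.le hw
    simp only [point, parabolaPoint, sub_self] at h
    rcases mul_eq_zero.1 h.symm with h | h
    · rw [hf (sub_eq_zero.1 h)]; exact Sym2.mem_mk_left u v
    · rw [← hf (sub_eq_zero.1 h)]; exact Sym2.mem_mk_right u v
  · rintro e he e' he' hne x ⟨hx, hx'⟩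
    obtain ⟨a, b, rfl, hab, hlt⟩ := hordered e he
    obtain ⟨c, d, rfl, hcd, hlt'⟩ := hordered e' he'
    obtain ⟨t, h1, h2, rfl⟩ := chord_inter_chord hlt hlt'
      (fun h => hne (by rw [hf h.1, hf h.2]))
      (fun h => hcross a c b d hab hcd h.1 h.2.1 h.2.2)
      (fun h => hcross c a d b hcd hab h.1 h.2.1 h.2.2) hx hx'
    obtain ⟨w, hw, hwe⟩ : ∃ w, f w = t ∧ w ∈ s(a, b) := by
      rcases h1 with rfl | rfl
      · exact ⟨a, rfl, Sym2.mem_mk_left a b⟩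
      · exact ⟨b, rfl, Sym2.mem_mk_right a b⟩
    refine ⟨w, hwe, ?_, by simp only [point, hw]⟩
    subst hw
    rcases h2 with h | h
    · rw [hf h]; exact Sym2.mem_mk_left c d
    · rw [hf h]; exact Sym2.mem_mk_right c d

theorem corollary17p1 {V : Type*} [Finite V] [DecidableEq V] (G : SimpleGraph V)
    (hG : InEpsilon 3 G) : IsPlanarGraph G := by
  obtain ⟨⟨hconn, u, p, hp⟩, hmod⟩ := hG
  have hodd : ∀ (v : V) (c : G.Walk v v), c.IsCycle → Odd c.length := by
    intro v c hc
    have h : c.length % 4 = 3 := hmod v c hc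
    exact Nat.odd_iff.2 (by omega)
  obtain ⟨f, hinj, hcross⟩ := SimpleGraph.Walk.IsTrail.exists_noncrossing hodd p hp.isTrail
  refine isPlanarGraph_of_noncrossing f
    (fun x y hxy => hinj (hp.mem_support_of_connected hconn x)
      (hp.mem_support_of_connected hconn y) hxy) ?_
  intro a b c d hac hbd
  exact hcross a b c d (hp.mem_edges_iff.2 hac) (hp.mem_edges_iff.2 hbd)
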